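/- For a measurable space $S$ let $\mathbb{S}(S)$ be the set of all subprobability measures on $S$ with the weak-$*$-$\sigma$-algebra (generated by the evaluations $\mu\mapsto\mu(A)$, $A\subseteq S$ measurable), and for measurable $f:S\to T$ let $\mathbb{S}f:\mathbb{S}(S)\to\mathbb{S}(T)$ be $(\mathbb{S}f)(\nu)(B)=\nu(f^{-1}[B])$. Let $w(S)$ be the set of all measurable subsets of $\mathbb{S}(S)$, ordered by inclusion and equipped with the hit $\sigma$-algebra, i.e. the one generated by the sets $\{D\in w(S) : D\cap A\neq\emptyset\}$, $A\in w(S)$. - A *nondeterministic kernel* on $S$ is a measurable map $\kappa:S\to w(S)$. A *morphism of nondeterministic kernels* from $\kappa:S\to w(S)$ to $\kappa':T\to w(T)$ is a measurable map $f:S\to T$ with $\kappa(s)=(\mathbb{S}f)^{-1}[\kappa'(f(s))]$ for all $s\in S$. - A *stochastic effectivity function* on $S$ is a map $P$ from $S$ to the upper closed subsets of $w(S)$ which is *t-measurable*: for every measurable $H\subseteq\mathbb{S}(S)\times[0,1]$, the set $\{(s,q)\in S\times[0,1] : \{\mu : (\mu,q)\in H\}\in P(s)\}$ is measurable. - A *strong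 morphism* between effectivity functions $P$ on $S$ and $Q$ on $T$ is a surjective measurable map $f:S\to T$ such that, for all $s\in S$ and $A\in w(S)$, $A\in P(s)$ if and only if $(\mathbb{S}f)^{-1}[B]\subseteq A$ for some $B\in Q(f(s))$. - For $\kappa:S\to w(S)$ put $(\mathfrak{F}\kappa)(s)=\{U\in w(S) : \kappa(s)\subseteq U\}$. A *generating kernel* is a nondeterministic kernel $\kappa$ such that $\mathfrak{F}\kappa$ is t-measurable. An effectivity function $P$ on $S$ is *filter-generated* if $P=\mathfrak{F}\kappa$ for some map $\kappa:S\to w(S)$. **Theorem.** 1. Let $S$ and $T$ be standard Borel spaces, and let $\kappa:S\to w(S)$ and $\kappa':T\to w(T)$ be generating kernels. A surjective measurable map $f:S\to T$ is a strong morphism between $\mathfrak{F}\kappa$ and $\mathfrak{F}\kappa'$ if and only if it is a morphism of nondeterministic kernels from $\kappa$ to $\kappa'$. 2. The assignment $\kappa\mapsto\mathfrak{F}\kappa$ on objects and $f\mapsto f$ on arrows is a well-defined full functor from the category of generating kernels over standard Borel spaces, with surjective morphisms of nondeterministic kernels as arrows, to the category of filter-generated effectivity functions over standard Borel spaces, with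 strong morphisms as arrows. -/

import Mathlib

open CategoryTheory

universe u v w

namespace StochEff

/-! ### Subprobability measures and their functorial action -/

/-- The set of all subprobability measures on a measurable space. Its σ-algebra is the
weak-* σ-algebra, generated by the evaluations at measurable sets: the trace of Mathlib's
σ-algebra on `Measure S`. -/
abbrev SubProb (S : Type u) [MeasurableSpace S] : Type u :=
  {μ : MeasureTheory.Measure S // μ Set.univ ≤ 1}

/-- The image of a subprobability measure under a measurable map:
`(SubProb.map f ν)(B) = ν (f ⁻¹ B)` for measurable `B`. -/
noncomputable def SubProb.map {S : Type u} {T : Type v} [MeasurableSpace S] [MeasurableSpace T]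
    (f : S → T) (hf : Measurable f) (ν : SubProb S) : SubProb T :=
  ⟨ν.1.map f, by
    rw [MeasureTheory.Measure.map_apply hf MeasurableSet.univ, Set.preimage_univ]
    exact ν.2⟩

theorem SubProb.measurable_map {S : Type u} {T : Type v} [MeasurableSpace S] [MeasurableSpace T]
    (f : S → T) (hf : Measurable f) : Measurable (SubProb.map f hf) :=
  ((MeasureTheory.Measure.measurable_map f hf).comp measurable_subtype_coe).subtype_mk

theorem SubProb.map_id {S : Type u} [MeasurableSpace S] (ν : SubProb S) :
    SubProb.map id measurable_id ν = ν :=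
  Subtype.ext MeasureTheory.Measure.map_id

theorem SubProb.map_map {S : Type u} {T : Type v} {U : Type w}
    [MeasurableSpace S] [MeasurableSpace T] [MeasurableSpace U]
    {f : S → T} (hf : Measurable f) {g : T → U} (hg : Measurable g) (ν : SubProb S) :
    SubProb.map g hg (SubProb.map f hf ν) = SubProb.map (g ∘ f) (hg.comp hf) ν :=
  Subtype.ext (MeasureTheory.Measure.map_map hg hf)

/-! ### σ-algebras as ordered sets, with their hit σ-algebra -/

/-- The σ-algebra of a measurable space `X`, as the set of all measurable subsets of `X`. -/
def MeasSet (X : Type u) [MeasurableSpace X] : Type u := {H : Set X // MeasurableSet H}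

/-- Measurable sets are ordered by inclusion. -/
instance MeasSet.instPartialOrder (X : Type u) [MeasurableSpace X] : PartialOrder (MeasSet X) :=
  Subtype.partialOrder _

/-- The hit σ-algebra on the set of all measurable subsets of `X`: the smallest one containing
`{D | D ∩ A ≠ ∅}` for all measurable `A`. -/
instance MeasSet.hitSigmaAlgebra (X : Type u) [MeasurableSpace X] : MeasurableSpace (MeasSet X) :=
  MeasurableSpace.generateFrom
    {E | ∃ A : MeasSet X, E = {D : MeasSet X | (D.1 ∩ A.1).Nonempty}}

/-- `W S` is the set of all measurable sets of subprobability measures on `S`, ordered by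
inclusion and equipped with the hit σ-algebra. -/
abbrev W (S : Type u) [MeasurableSpace S] : Type u := MeasSet (SubProb S)

/-- The contravariant action of `W` on measurable maps: `H ↦ (SubProb.map f)⁻¹ H`. -/
def W.comap {S : Type u} {T : Type v} [MeasurableSpace S] [MeasurableSpace T]
    (f : S → T) (hf : Measurable f) (H : W T) : W S :=
  ⟨SubProb.map f hf ⁻¹' H.1, SubProb.measurable_map f hf H.2⟩

theorem W.comap_id {S : Type u} [MeasurableSpace S] (H : W S) :
    W.comap id measurable_id H = H :=
  Subtype.ext (by ext ν; simp [W.comap, SubProb.map_id])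

theorem W.comap_comap {S : Type u} {T : Type v} {U : Type w}
    [MeasurableSpace S] [MeasurableSpace T] [MeasurableSpace U]
    {f : S → T} (hf : Measurable f) {g : T → U} (hg : Measurable g) (H : W U) :
    W.comap f hf (W.comap g hg H) = W.comap (g ∘ f) (hg.comp hf) H :=
  Subtype.ext (by ext ν; simp [W.comap, SubProb.map_map])

theorem W.comap_mono {S : Type u} {T : Type v} [MeasurableSpace S] [MeasurableSpace T]
    {f : S → T} (hf : Measurable f) {H K : W T} (h : H ≤ K) : W.comap f hf H ≤ W.comap f hf K :=
  fun _ hν => h hν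

/-! ### Nondeterministic kernels and their morphisms -/

/-- A nondeterministic kernel on `S` is a hit-measurable map `S → W S`. -/
structure NondetKernel (S : Type u) [MeasurableSpace S] where
  toFun : S → W S
  hit_measurable : Measurable toFun

/-- Morphisms of nondeterministic kernels: measurable maps `f` with
`κ s = (SubProb.map f)⁻¹ (κ' (f s))` for all `s`. -/
structure IsNKMorphism {S : Type u} {T : Type v} [MeasurableSpace S] [MeasurableSpace T]
    (κ : NondetKernel S) (κ' : NondetKernel T) (f : S → T) : Prop where
  measurable : Measurable f
  commutes : ∀ s, κ.toFun s = W.comap f measurable (κ'.toFun (f s))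

/-! ### Stochastic effectivity functions and strong morphisms -/

/-- `Upper T` is the set of all upper closed subsets of `W T`. -/
abbrev Upper (T : Type u) [MeasurableSpace T] : Type u := UpperSet (W T)

/-- The horizontal section `H_q = {μ | (μ, q) ∈ H}` of a measurable set `H`. -/
def horizSection {T : Type u} [MeasurableSpace T] (H : MeasSet (SubProb T × unitInterval))
    (q : unitInterval) : W T :=
  ⟨{μ | (μ, q) ∈ H.1}, measurable_prodMk_right H.2⟩

/-- `P` is t-measurable if `{(s, q) | H_q ∈ P s}` is measurable in `S × [0,1]` for every
measurable `H ⊆ SubProb T × [0,1]`. -/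
def TMeasurable {S : Type u} {T : Type v} [MeasurableSpace S] [MeasurableSpace T]
    (P : S → Upper T) : Prop :=
  ∀ H : MeasSet (SubProb T × unitInterval),
    MeasurableSet {p : S × unitInterval | horizSection H p.2 ∈ P p.1}

/-- A stochastic effectivity function from `S` to `T`. -/
structure EffFun (S : Type u) (T : Type v) [MeasurableSpace S] [MeasurableSpace T] where
  toFun : S → Upper T
  tMeasurable : TMeasurable toFun

/-- Strong morphisms of effectivity functions: surjective measurable maps `f` such that
`A ∈ P s` iff `(SubProb.map f)⁻¹ B ⊆ A` for some `B ∈ Q (f s)`. -/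
structure IsStrongMorphism {S : Type u} {T : Type v} [MeasurableSpace S] [MeasurableSpace T]
    (P : EffFun S S) (Q : EffFun T T) (f : S → T) : Prop where
  measurable : Measurable f
  surjective : Function.Surjective f
  strong : ∀ (s : S) (A : W S),
    A ∈ P.toFun s ↔ ∃ B ∈ Q.toFun (f s), W.comap f measurable B ≤ A

/-! ### Generation of effectivity functions from kernels -/

/-- The principal filter `{U | D ⊆ U}` in `W S` generated by `D`. -/
def filterGen {S : Type u} [MeasurableSpace S] (D : W S) : Upper S where
  carrier := {U | D ≤ U}
  upper' := fun _ _ h hD => le_trans hD h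

/-- An effectivity function is filter-generated if it is pointwise the principal filter
generated by some map `κ : S → W S`. -/
def EffFun.IsFilterGenerated {S : Type u} [MeasurableSpace S] (P : EffFun S S) : Prop :=
  ∃ κ : S → W S, ∀ s, P.toFun s = filterGen (κ s)

/-- A generating kernel is a nondeterministic kernel `κ` for which `s ↦ filterGen (κ s)` is
t-measurable. -/
structure GeneratingKernel (S : Type u) [MeasurableSpace S] extends NondetKernel S where
  tMeasurable : TMeasurable fun s => filterGen (toFun s)

/-- The effectivity function `𝔉 κ` generated by a generating kernel `κ`. -/
def GeneratingKernel.eff {S : Type u} [MeasurableSpace S] (κ : GeneratingKernel S) :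
    EffFun S S where
  toFun := fun s => filterGen (κ.toFun s)
  tMeasurable := κ.tMeasurable

/-! ### The two categories -/

/-- A generating kernel over a standard Borel space. -/
structure GenKer : Type (u + 1) where
  carrier : Type u
  [measurableSpace : MeasurableSpace carrier]
  [standardBorel : StandardBorelSpace carrier]
  kernel : GeneratingKernel carrier

attribute [instance] GenKer.measurableSpace GenKer.standardBorel

/-- The category of generating kernels over standard Borel spaces, with surjective morphisms of
nondeterministic kernels. -/
instance GenKer.instCategory : Category GenKer.{u} where
  Hom X Y := {f : X.carrier → Y.carrier //
    IsNKMorphism X.kernel.toNondetKernel Y.kernel.toNondetKernel f ∧ Function.Surjective f}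
  id X := ⟨id, ⟨measurable_id, fun _ => (W.comap_id _).symm⟩, Function.surjective_id⟩
  comp f g := ⟨g.1 ∘ f.1,
    ⟨g.2.1.measurable.comp f.2.1.measurable, fun s => by
      rw [f.2.1.commutes, g.2.1.commutes, W.comap_comap]; rfl⟩,
    g.2.2.comp f.2.2⟩

/-- A filter-generated effectivity function over a standard Borel space. -/
structure FilEff : Type (u + 1) where
  carrier : Type u
  [measurableSpace : MeasurableSpace carrier]
  [standardBorel : StandardBorelSpace carrier]
  eff : EffFun carrier carrier
  filterGenerated : eff.IsFilterGenerated

attribute [instance] FilEff.measurableSpace FilEff.standardBorel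

theorem IsStrongMorphism.id {S : Type u} [MeasurableSpace S] (P : EffFun S S) :
    IsStrongMorphism P P _root_.id where
  measurable := measurable_id
  surjective := Function.surjective_id
  strong s A := by
    simp only [W.comap_id, id_eq]
    exact ⟨fun h => ⟨A, h, le_rfl⟩, fun ⟨_, hB, h⟩ => (P.toFun s).upper h hB⟩

theorem IsStrongMorphism.comp {S : Type u} {T : Type v} {U : Type w}
    [MeasurableSpace S] [MeasurableSpace T] [MeasurableSpace U]
    {P : EffFun S S} {Q : EffFun T T} {R : EffFun U U} {f : S → T} {g : T → U}
    (hg : IsStrongMorphism Q R g) (hf : IsStrongMorphism P Q f) :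
    IsStrongMorphism P R (g ∘ f) where
  measurable := hg.measurable.comp hf.measurable
  surjective := hg.surjective.comp hf.surjective
  strong s A := by
    rw [hf.strong]
    constructor
    · rintro ⟨B, hB, hBA⟩
      obtain ⟨C, hC, hCB⟩ := (hg.strong _ _).1 hB
      refine ⟨C, hC, ?_⟩
      rw [← W.comap_comap hf.measurable hg.measurable]
      exact le_trans (W.comap_mono _ hCB) hBA
    · rintro ⟨C, hC, hCA⟩
      refine ⟨W.comap g hg.measurable C, (hg.strong _ _).2 ⟨C, hC, le_rfl⟩, ?_⟩
      rwa [W.comap_comap hf.measurable hg.measurable]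

/-- The category of filter-generated effectivity functions over standard Borel spaces, with
strong morphisms. -/
instance FilEff.instCategory : Category FilEff.{u} where
  Hom X Y := {f : X.carrier → Y.carrier // IsStrongMorphism X.eff Y.eff f}
  id X := ⟨id, IsStrongMorphism.id X.eff⟩
  comp f g := ⟨g.1 ∘ f.1, g.2.comp f.2⟩

/-- The object part of `𝔉`: a generating kernel is sent to the effectivity function it
generates, over the same space. -/
def filObj (X : GenKer.{u}) : FilEff.{u} where
  carrier := X.carrier
  eff := X.kernel.eff
  filterGenerated := ⟨X.kernel.toFun, fun _ => rfl⟩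

end StochEff

namespace StochEff

/-! A principal filter is determined by its least element. Preimage under `SubProb.map f` is
monotone, so among the preimages of members of the filter generated by `κ' (f s)` the smallest is
the preimage of `κ' (f s)` itself. The strong morphism condition at `s` therefore says that `κ s`
and this preimage have the same measurable supersets. As both are measurable sets, this holds
exactly when they are equal, which is the condition for a morphism of kernels. The equivalence
leaves the underlying map unchanged. Read from right to left it makes `𝔉` well defined on arrows;
read from left to right it makes `𝔉` full. -/

theorem mem_filterGen {S : Type u} [MeasurableSpace S] {D U : W S} :
    U ∈ filterGen D ↔ D ≤ U :=
  Iff.rfl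

/-- The sets containing the preimage of some member of a principal filter are those containing
the preimage of its generator. -/
theorem exists_mem_filterGen_comap_le_iff {S : Type u} {T : Type v}
    [MeasurableSpace S] [MeasurableSpace T] {f : S → T} (hf : Measurable f) {D : W T} {A : W S} :
    (∃ B ∈ filterGen D, W.comap f hf B ≤ A) ↔ W.comap f hf D ≤ A :=
  ⟨fun ⟨_, hB, hBA⟩ => (W.comap_mono hf (mem_filterGen.1 hB)).trans hBA,
    fun h => ⟨D, mem_filterGen.2 le_rfl, h⟩⟩

/-- Both conditions are pointwise in `s`, and each compares `κ s` with the preimage of `κ' (f s)`: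
one through their upper sets in `W S`, the other directly. Surjectivity belongs only to the notion
of strong morphism, so it has to be supplied from outside. -/
theorem isStrongMorphism_eff_iff {S : Type u} {T : Type v} [MeasurableSpace S] [MeasurableSpace T]
    {κ : GeneratingKernel S} {κ' : GeneratingKernel T} {f : S → T}
    (hsurj : Function.Surjective f) :
    IsStrongMorphism κ.eff κ'.eff f ↔ IsNKMorphism κ.toNondetKernel κ'.toNondetKernel f := by
  constructor
  · intro h
    -- Antisymmetry of inclusion: two elements of `W S` with the same upper bounds `A` coincide.
    refine ⟨h.measurable, fun s => eq_of_forall_ge_iff fun A => ?_⟩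
    exact (h.strong s A).trans (exists_mem_filterGen_comap_le_iff h.measurable)
  · intro h
    refine ⟨h.measurable, hsurj, fun s A => ?_⟩
    refine Iff.trans ?_ (exists_mem_filterGen_comap_le_iff h.measurable).symm
    rw [← h.commutes s]
    exact mem_filterGen

/-- The functor sending a generating kernel to the effectivity function it generates. -/
def filFunctor : GenKer.{w} ⥤ FilEff.{w} where
  obj := filObj
  -- The functor laws are immediate, since identities and composites in both categories are those of
  -- the underlying functions.
  map f := ⟨f.1, (isStrongMorphism_eff_iff f.2.2).2 f.2.1⟩

/-- A strong morphism carries its own surjectivity, so its underlying function is already an arrow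
of generating kernels and serves as its own preimage. -/
instance filFunctor_full : filFunctor.{w}.Full where
  map_surjective g :=
    ⟨⟨g.1, (isStrongMorphism_eff_iff g.2.surjective).1 g.2, g.2.surjective⟩, rfl⟩

end StochEff

open StochEff

theorem mainTheorem5 :
    -- over standard Borel spaces, a surjective measurable map is a strong morphism between the
    -- generated effectivity functions iff it is a morphism of nondeterministic kernels
    (∀ (S : Type u) (T : Type v) [MeasurableSpace S] [MeasurableSpace T]
        [StandardBorelSpace S] [StandardBorelSpace T]
        (κ : GeneratingKernel S) (κ' : GeneratingKernel T) (f : S → T),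
        Measurable f → Function.Surjective f →
          (IsStrongMorphism κ.eff κ'.eff f ↔
            IsNKMorphism κ.toNondetKernel κ'.toNondetKernel f)) ∧
    -- the assignment `κ ↦ 𝔉 κ`, `f ↦ f` is well defined on arrows, and it is a full functor
    (∃ h : ∀ (X Y : GenKer.{w}) (f : X ⟶ Y),
        IsStrongMorphism (filObj X).eff (filObj Y).eff f.1,
      ∃ F : GenKer.{w} ⥤ FilEff.{w},
        F.toPrefunctor = { obj := filObj, map := fun {X Y} f => ⟨f.1, h X Y f⟩ } ∧
        F.Full) := by
  exact ⟨fun S T _ _ _ _ κ κ' f _ hsurj => isStrongMorphism_eff_iff hsurj,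
    fun X Y f => (isStrongMorphism_eff_iff f.2.2).2 f.2.1,
    -- The prefunctors agree definitionally: the arrow maps have the same underlying function, and
    -- the attached proofs are irrelevant.
    filFunctor, rfl, filFunctor_full⟩
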